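/- Conventions. $\langle p,q\rangle=(p(0),q(0),p(1),q(1),\dots)$ for $p,q\in\mathbb{N}^{\mathbb{N}}$; for a computable bijective pairing $\langle n,k\rangle$ of natural numbers, $\langle p_0,p_1,\dots\rangle\langle n,k\rangle=p_n(k)$. A represented space is a set $X$ with a surjective partial map $\delta_X:\subseteq\mathbb{N}^{\mathbb{N}}\to X$; $\mathbb{N}^{\mathbb{N}}$ is represented by the identity. A partial multi-valued function $f:\subseteq X\rightrightarrows Y$ assigns to each $x\in X$ a set $f(x)\subseteq Y$, and $\mathrm{dom}(f)=\{x: f(x)\neq\emptyset\}$. A partial function $F:\subseteq\mathbb{N}^{\mathbb{N}}\to\mathbb{N}^{\mathbb{N}}$ is a realizer of $f:\subseteq X\rightrightarrows Y$ if $\delta_Y F(p)\in f(\delta_X(p))$ (in particular both sides are defined) for all $p$ with $\delta_X(p)\in\mathrm{dom}(f)$. For multi-valued functions $f,g$ on represented spaces, $f\leq_{\mathrm W} g$ (Weihrauch reducibility) means that there are computable $H,K:\subseteq\mathbb{N}^{\mathbb{N}}\to\mathbb{N}^{\mathbb{N}}$ such that $H\langle \mathrm{id},GK\rangle$ is a realizer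 of $f$ for every realizer $G$ of $g$; in the continuous version (reducibility with respect to some oracle), $H$ and $K$ are only required to be continuous on their domains. The composition of $f:\subseteq X\rightrightarrows Y$ and $g:\subseteq Y\rightrightarrows Z$ has domain $\{x\in\mathrm{dom}(f): f(x)\subseteq\mathrm{dom}(g)\}$ and values $(g\circ f)(x)=\bigcup_{y\in f(x)}g(y)$ there. $\mathrm{LLPO}:\subseteq\mathbb{N}^{\mathbb{N}}\rightrightarrows\mathbb{N}$ has as domain the sequences $p$ with $p(k)\neq0$ for at most one $k$; for such $p$, $\mathrm{LLPO}(p)\subseteq\{0,1\}$ contains $0$ iff $p(2n)=0$ for all $n$, and $1$ iff $p(2n+1)=0$ for all $n$. Its parallelization is regarded as $\widehat{\mathrm{LLPO}}:\subseteq\mathbb{N}^{\mathbb{N}}\rightrightarrows\mathbb{N}^{\mathbb{N}}$, $\widehat{\mathrm{LLPO}}\langle p_0,p_1,\dots\rangle=\prod_{i}\mathrm{LLPO}(p_i)$. Proposition (Composition). Let $X,Y,Z$ be represented spaces and let $f:\subseteq X\rightrightarrows Y$ and $g:\subseteq Y\rightrightarrows Z$ be multi-valued operations. If $f\leq_{\mathrm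 W}\widehat{\mathrm{LLPO}}$ and $g\leq_{\mathrm W}\widehat{\mathrm{LLPO}}$, then $g\circ f\leq_{\mathrm W}\widehat{\mathrm{LLPO}}$. The same holds if Weihrauch reducibility is replaced by its continuous version in all three places. In other words, the weakly computable operations (those $f$ with $f\leq_{\mathrm W}\widehat{\mathrm{LLPO}}$) are closed under composition, and so are the weakly continuous ones (those reducible to $\widehat{\mathrm{LLPO}}$ in the continuous sense). -/

import Mathlib

namespace Weihrauch

/-- Baire space, with the product topology of the discrete space of natural numbers. -/
abbrev Baire : Type := ℕ → ℕ

/-- The finite initial segment `p(0), …, p(k-1)`. -/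
def initSeg (p : Baire) (k : ℕ) : List ℕ := (List.range k).map p

/-- A partial function `F` on Baire space is computable if some computable function `φ` on finite
words, monotone with respect to the prefix order, produces the output from the input: for every `p`
in the domain of `F`, the words `φ (p(0) … p(k-1))` exhaust the infinite sequence `F(p)`.
(What `φ` does on inputs outside the domain is irrelevant, so restrictions of computable functions
are computable.) -/
def IsComputable (F : Baire →. Baire) : Prop :=
  ∃ φ : List ℕ → List ℕ, Computable φ ∧ (∀ u v, u <+: v → φ u <+: φ v) ∧
    ∀ p q, q ∈ F p → ∀ n, ∃ k, (φ (initSeg p k))[n]? = some (q n)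

/-- A partial function on Baire space is continuous if it is so as a function on its domain, with
the subspace topology. -/
def IsContinuous (F : Baire →. Baire) : Prop := Continuous F.asSubtype

/-- The pairing `⟨p, q⟩ = (p(0), q(0), p(1), q(1), …)`. -/
def pair (p q : Baire) : Baire := fun n => if n % 2 = 0 then p (n / 2) else q (n / 2)

/-- The inverse of the countable tupling, `⟨p₀, p₁, p₂, …⟩ ↦ (p₀, p₁, p₂, …)`, where
`⟨p₀, p₁, p₂, …⟩⟨n, k⟩ = pₙ(k)`. -/
def untuple (p : Baire) : ℕ → Baire := fun n k => p (Nat.pair n k)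

/-- `⟨id, F⟩`. -/
def idPair (F : Baire →. Baire) : Baire →. Baire := fun p => (F p).map (pair p)

/-- A representation of `X`: a surjective partial map from Baire space to `X`. -/
structure Representation (X : Type*) where
  toPFun : Baire →. X
  surjective : ∀ x, ∃ p, x ∈ toPFun p

/-- Baire space is represented by the identity. -/
def baireRep : Representation Baire where
  toPFun := PFun.id Baire
  surjective x := ⟨x, Part.mem_some x⟩

/-- A partial multi-valued function `f :⊆ X ⇉ Y`; a point `x` lies outside the domain of `f` exactly
if `f x` is empty. -/
abbrev MultiFun (X Y : Type*) : Type _ := X → Set Y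

/-- The domain of a multi-valued function. -/
def MultiFun.dom {X Y : Type*} (f : MultiFun X Y) : Set X := {x | (f x).Nonempty}

/-- The composition `g ∘ f`, with domain `{x ∈ dom f | f x ⊆ dom g}`. -/
def MultiFun.comp {X Y Z : Type*} (g : MultiFun Y Z) (f : MultiFun X Y) : MultiFun X Z :=
  fun x => {z | f x ⊆ MultiFun.dom g ∧ ∃ y ∈ f x, z ∈ g y}

/-- `F` is a realizer of `f`: for every name `p` of a point `x` in the domain of `f`, `F(p)` is
defined and is a name of an element of `f x`. -/
def IsRealizer {X Y : Type*} (δX : Representation X) (δY : Representation Y) (f : MultiFun X Y)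
    (F : Baire →. Baire) : Prop :=
  ∀ p, ∀ x ∈ δX.toPFun p, x ∈ MultiFun.dom f → ∃ q ∈ F p, ∃ y ∈ δY.toPFun q, y ∈ f x

/-- Reducibility of sets of functions on Baire space, with translations `H`, `K` in the class `C`:
for every `G ∈ 𝓖` there is `F ∈ 𝓕` with `F = H ⟨id, G K⟩`. -/
def SetReducible (C : (Baire →. Baire) → Prop) (𝓕 𝓖 : Set (Baire →. Baire)) : Prop :=
  ∃ H K : Baire →. Baire, C H ∧ C K ∧ ∀ G ∈ 𝓖, ∃ F ∈ 𝓕, F = H.comp (idPair (G.comp K))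

/-- Weihrauch reducibility `f ≤_W g` of multi-valued functions on represented spaces. -/
def LeqW {X Y U V : Type*} (δX : Representation X) (δY : Representation Y) (f : MultiFun X Y)
    (δU : Representation U) (δV : Representation V) (g : MultiFun U V) : Prop :=
  SetReducible IsComputable {F | IsRealizer δX δY f F} {G | IsRealizer δU δV g G}

/-- Continuous Weihrauch reducibility (Weihrauch reducibility with respect to some oracle). -/
def ContLeqW {X Y U V : Type*} (δX : Representation X) (δY : Representation Y) (f : MultiFun X Y)
    (δU : Representation U) (δV : Representation V) (g : MultiFun U V) : Prop :=
  SetReducible IsContinuous {F | IsRealizer δX δY f F} {G | IsRealizer δU δV g G}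

/-- The lesser limited principle of omniscience; its domain consists of the sequences with at most
one nonzero entry. -/
def LLPO : MultiFun Baire ℕ := fun p =>
  {i | (∀ k l, p k ≠ 0 → p l ≠ 0 → k = l) ∧
    ((i = 0 ∧ ∀ n, p (2 * n) = 0) ∨ (i = 1 ∧ ∀ n, p (2 * n + 1) = 0))}

/-- The parallelization of `f`: the countable product of `f` with itself. -/
def parallelization {X Y : Type*} (f : MultiFun X Y) : MultiFun (ℕ → X) (ℕ → Y) :=
  fun x => {y | ∀ i, y i ∈ f (x i)}

/-- Parallelized `LLPO`, as a multi-valued function from Baire space to Baire space. -/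
def parLLPO : MultiFun Baire Baire := fun p => parallelization LLPO (untuple p)

/-- `f` is weakly computable if `f` is Weihrauch reducible to parallelized `LLPO`. -/
def WeaklyComputable {X Y : Type*} (δX : Representation X) (δY : Representation Y)
    (f : MultiFun X Y) : Prop :=
  LeqW δX δY f baireRep baireRep parLLPO

/-- `f` is weakly continuous if `f` is continuously Weihrauch reducible to parallelized `LLPO`. -/
def WeaklyContinuous {X Y : Type*} (δX : Representation X) (δY : Representation Y)
    (f : MultiFun X Y) : Prop :=
  ContLeqW δX δY f baireRep baireRep parLLPO

end Weihrauch

namespace Weihrauch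

/-! Solving parallelized `LLPO` amounts to finding a binary path that is never refuted by finite
information, which is weak Kőnig's lemma. In this form two consecutive instances merge into one.
Given `p`, consider pairs `(r, s)` such that `r` solves the instance `a` that the first reduction
computes from `p`, and `s` solves the instance `b` that the second reduction computes from its input
`q`, the output of the first on `pair p r`. Any failure of `r` or `s` shows up in finite words, so
the correct pairs are the binary paths avoiding a decidable persistent relation `bad`. It does not
matter that `b` depends on the guess `r`: as long as `r` is wrong, nothing is claimed about `s`.

`exists_path_of_parLLPO` finds such a path with a single use of parallelized `LLPO`. A node is dead
once every extension of a certain length is refuted. For each node one instance of `LLPO` asks for a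
child that is not the only dead one, and following the answers from the root never reaches a dead
node. `WordReducible.comp` combines this with `bad_eq_false` (correct pairs are avoiding paths) and
its converses `mem_parLLPO_of_bad_left` and `mem_parLLPO_of_bad_right`.

Both versions are handled at once by expressing reducibility through monotone word functions
(`setReducible_iff_wordReducible`): computable ones give the computable version, arbitrary ones the
continuous version (`IsContinuous.exists_word`). -/

/-- A function on finite words that is monotone with respect to the prefix order. -/
def WordMono (φ : List ℕ → List ℕ) : Prop := ∀ u v, u <+: v → φ u <+: φ v

/-- The words `φ (p(0) … p(k-1))` exhaust the infinite sequence `q`. -/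
def Approximates (φ : List ℕ → List ℕ) (p q : Baire) : Prop :=
  ∀ n, ∃ k, (φ (initSeg p k))[n]? = some (q n)

/-! ### Initial segments and monotone word functions -/

@[simp] theorem initSeg_length (p : Baire) (k : ℕ) : (initSeg p k).length = k := by
  simp [initSeg]

theorem initSeg_getElem? (p : Baire) {k n : ℕ} (h : n < k) : (initSeg p k)[n]? = some (p n) := by
  simp [initSeg, h]

theorem initSeg_getElem?_eq_some {p : Baire} {k n x : ℕ} :
    (initSeg p k)[n]? = some x ↔ n < k ∧ p n = x := by
  by_cases h : n < k
  · rw [initSeg_getElem? p h]; simp [h]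
  · simp [initSeg, h]

theorem initSeg_take (p : Baire) {k l : ℕ} (h : k ≤ l) : (initSeg p l).take k = initSeg p k := by
  simp [initSeg, ← List.map_take, List.take_range, h]

theorem initSeg_succ (p : Baire) (k : ℕ) : initSeg p (k + 1) = initSeg p k ++ [p k] := by
  simp [initSeg, List.range_succ]

theorem initSeg_prefix (p : Baire) {k l : ℕ} (h : k ≤ l) : initSeg p k <+: initSeg p l := by
  rw [← initSeg_take p h]; exact List.take_prefix _ _

theorem initSeg_congr {p q : Baire} {k : ℕ} (h : ∀ n < k, p n = q n) :
    initSeg p k = initSeg q k := by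
  simp only [initSeg]
  exact List.map_congr_left fun n hn => h n (List.mem_range.1 hn)

theorem getElem?_of_prefix {u v : List ℕ} (h : u <+: v) {n x : ℕ} (hx : u[n]? = some x) :
    v[n]? = some x := by
  obtain ⟨w, rfl⟩ := h
  have hn : n < u.length := (List.getElem?_eq_some_iff.1 hx).1
  rw [List.getElem?_append_left hn, hx]

theorem prefix_of_getElem? {u v : List ℕ} (h : ∀ (n x : ℕ), u[n]? = some x → v[n]? = some x) :
    u <+: v := by
  rw [List.prefix_iff_getElem?]
  intro i hi
  exact h i _ (List.getElem?_eq_getElem hi)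

theorem WordMono.initSeg {φ : List ℕ → List ℕ} (hφ : WordMono φ) (p : Baire) {k l : ℕ}
    (h : k ≤ l) : φ (initSeg p k) <+: φ (initSeg p l) :=
  hφ _ _ (initSeg_prefix p h)

/-- Monotone words are consistent with the sequence they exhaust. -/
theorem Approximates.eq_of_getElem? {φ : List ℕ → List ℕ} {p q : Baire} (h : Approximates φ p q)
    (hφ : WordMono φ) {k n x : ℕ} (hx : (φ (initSeg p k))[n]? = some x) : q n = x := by
  obtain ⟨l, hl⟩ := h n
  have h1 := getElem?_of_prefix (hφ.initSeg p (le_max_left k l)) hx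
  have h2 := getElem?_of_prefix (hφ.initSeg p (le_max_right k l)) hl
  rw [h1] at h2
  exact (Option.some.inj h2).symm

theorem Approximates.unique {φ : List ℕ → List ℕ} {p q q' : Baire} (hφ : WordMono φ)
    (h : Approximates φ p q) (h' : Approximates φ p q') : q = q' := by
  funext n
  obtain ⟨k, hk⟩ := h' n
  exact h.eq_of_getElem? hφ hk

theorem Approximates.exists_prefix {φ : List ℕ → List ℕ} {p q : Baire} (h : Approximates φ p q)
    (hφ : WordMono φ) (n : ℕ) : ∃ k, initSeg q n <+: φ (initSeg p k) := by
  induction n with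
  | zero => exact ⟨0, by simp [Weihrauch.initSeg]⟩
  | succ n ih =>
    obtain ⟨k, hk⟩ := ih
    obtain ⟨l, hl⟩ := h n
    refine ⟨max k l, prefix_of_getElem? fun i x hx => ?_⟩
    obtain ⟨hi, rfl⟩ := initSeg_getElem?_eq_some.1 hx
    rcases Nat.lt_succ_iff_lt_or_eq.1 hi with hi | rfl
    · exact getElem?_of_prefix (hk.trans (hφ.initSeg p (le_max_left k l)))
        (initSeg_getElem? q hi)
    · exact getElem?_of_prefix (hφ.initSeg p (le_max_right k l)) hl

theorem Approximates.prefix_initSeg {φ : List ℕ → List ℕ} {p q : Baire} (h : Approximates φ p q)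
    (hφ : WordMono φ) (k : ℕ) :
    ∃ n, φ (Weihrauch.initSeg p k) <+: initSeg q n := by
  refine ⟨(φ (Weihrauch.initSeg p k)).length, prefix_of_getElem? fun n x hx => ?_⟩
  rw [initSeg_getElem?_eq_some]
  exact ⟨(List.getElem?_eq_some_iff.1 hx).1, h.eq_of_getElem? hφ hx⟩

theorem WordMono.comp {φ ψ : List ℕ → List ℕ} (hψ : WordMono ψ) (hφ : WordMono φ) :
    WordMono (fun u => ψ (φ u)) := fun u v h => hψ _ _ (hφ u v h)

theorem Approximates.comp {φ ψ : List ℕ → List ℕ} {p q r : Baire} (hψ : WordMono ψ)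
    (hφ : WordMono φ) (h' : Approximates ψ q r) (h : Approximates φ p q) :
    Approximates (fun u => ψ (φ u)) p r := by
  intro n
  obtain ⟨k, hk⟩ := h' n
  obtain ⟨l, hl⟩ := h.exists_prefix hφ k
  exact ⟨l, getElem?_of_prefix (hψ _ _ hl) hk⟩

/-! ### Partial functions on Baire space induced by word functions -/

/-- The partial function on Baire space given by a function on words. -/
noncomputable def ofWord (φ : List ℕ → List ℕ) : Baire →. Baire :=
  fun p => ⟨∃ q, Approximates φ p q, fun h => h.choose⟩

theorem mem_ofWord {φ : List ℕ → List ℕ} (hφ : WordMono φ) {p q : Baire} :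
    q ∈ ofWord φ p ↔ Approximates φ p q := by
  constructor
  · rintro ⟨h, rfl⟩
    exact h.choose_spec
  · intro h
    exact ⟨⟨q, h⟩, Approximates.unique hφ (Exists.choose_spec ⟨q, h⟩) h⟩

theorem isComputable_ofWord {φ : List ℕ → List ℕ} (hφ : WordMono φ) (hc : Computable φ) :
    IsComputable (ofWord φ) :=
  ⟨φ, hc, hφ, fun _ _ h => (mem_ofWord hφ).1 h⟩

theorem isOpen_initSeg (p : Baire) (k : ℕ) : IsOpen {p' : Baire | initSeg p' k = initSeg p k} := by
  have : {p' : Baire | initSeg p' k = initSeg p k} = ⋂ n ∈ Finset.range k, {p' | p' n = p n} := by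
    ext p'
    simp only [Set.mem_ofPred_eq, Set.mem_iInter, Finset.mem_range]
    constructor
    · intro h n hn
      have := initSeg_getElem? p' hn
      rw [h, initSeg_getElem? p hn] at this
      exact (Option.some.inj this).symm
    · exact fun h => initSeg_congr h
  rw [this]
  refine isOpen_biInter_finset fun n _ => ?_
  exact (isOpen_discrete ({p n} : Set ℕ)).preimage (continuous_apply (A := fun _ => ℕ) n)

theorem isContinuous_ofWord {φ : List ℕ → List ℕ} (hφ : WordMono φ) :
    IsContinuous (ofWord φ) := by
  refine continuous_pi fun n => ?_
  rw [continuous_discrete_rng]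
  intro b
  rw [isOpen_iff_mem_nhds]
  rintro ⟨p, hp⟩ hb
  have key : ∀ s : (ofWord φ).Dom, Approximates φ s.1 ((ofWord φ).asSubtype s) := fun s =>
    (mem_ofWord hφ).1 (Part.get_mem _)
  obtain ⟨k, hk⟩ := key ⟨p, hp⟩ n
  have ho := (isOpen_initSeg p k).preimage (continuous_subtype_val (p := (· ∈ (ofWord φ).Dom)))
  refine Filter.mem_of_superset (ho.mem_nhds (by simp)) ?_
  rintro ⟨p', hp'⟩ h
  simp only [Set.mem_preimage, Set.mem_ofPred_eq] at h
  rw [← h] at hk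
  have := (key ⟨p', hp'⟩).eq_of_getElem? hφ hk
  simp only [Set.mem_preimage, Set.mem_singleton_iff] at hb ⊢
  rw [this, hb]

theorem exists_nhds_initSeg (p : Baire) {s : Set Baire} (hs : s ∈ nhds p) :
    ∃ k, ∀ p', initSeg p' k = initSeg p k → p' ∈ s := by
  rw [nhds_pi, Filter.mem_pi] at hs
  obtain ⟨I, hI, t, ht, hts⟩ := hs
  obtain ⟨N, hN⟩ := hI.bddAbove
  refine ⟨N + 1, fun p' h => hts fun i hi => ?_⟩
  have hi' : i < N + 1 := Nat.lt_succ_of_le (hN hi)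
  have h1 := initSeg_getElem? p' hi'
  rw [h, initSeg_getElem? p hi'] at h1
  rw [← Option.some.inj h1]
  exact mem_of_mem_nhds (ht i)

/-- `w` is forced by `u` as an initial segment of the values of `F`. -/
def Forces (F : Baire →. Baire) (u w : List ℕ) : Prop :=
  w.length ≤ u.length ∧ ∃ k ≤ u.length, (∃ p q, q ∈ F p ∧ initSeg p k = u.take k) ∧
    ∀ p q, q ∈ F p → initSeg p k = u.take k → initSeg q w.length = w

theorem Forces.mono {F : Baire →. Baire} {u v w : List ℕ} (h : Forces F u w) (huv : u <+: v) :
    Forces F v w := by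
  obtain ⟨hl, k, hk, h1, h2⟩ := h
  have : v.take k = u.take k := by
    obtain ⟨t, rfl⟩ := huv
    rw [List.take_append_of_le_length hk]
  refine ⟨hl.trans huv.length_le, k, hk.trans huv.length_le, ?_, ?_⟩ <;> rwa [this]

/-- The two cylinders are given by prefixes of the same `u`, hence nested. The smaller one contains
a point of the domain, and its value begins with both words. -/
theorem Forces.prefix_of_le {F : Baire →. Baire} {u w w' : List ℕ} (h : Forces F u w)
    (h' : Forces F u w') (hl : w.length ≤ w'.length) : w <+: w' := by
  obtain ⟨-, k, hk, ⟨p, q, hq, hp⟩, h2⟩ := h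
  obtain ⟨-, k', hk', ⟨p', q', hq', hp'⟩, h2'⟩ := h'
  have step : ∀ {k l : ℕ} {p : Baire}, k ≤ l → initSeg p l = u.take l →
      initSeg p k = u.take k := by
    intro k l p hkl h
    rw [← initSeg_take p hkl, h, List.take_take, min_eq_left hkl]
  rcases le_total k k' with hkk | hkk
  · rw [← h2 p' q' hq' (step hkk hp'), ← h2' p' q' hq' hp']
    exact initSeg_prefix _ hl
  · rw [← h2 p q hq hp, ← h2' p q hq (step hkk hp)]
    exact initSeg_prefix _ hl

theorem exists_forces_max (F : Baire →. Baire) (u : List ℕ) :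
    ∃ w, (Forces F u w ∨ w = []) ∧ ∀ w', Forces F u w' → w' <+: w := by
  classical
  by_cases h : ∃ n ≤ u.length, ∃ w, w.length = n ∧ Forces F u w
  · obtain ⟨n, hn, w, hw, hf⟩ := h
    obtain ⟨w0, hw0, hf0⟩ := Nat.findGreatest_spec (P := fun n => ∃ w, w.length = n ∧ Forces F u w)
      hn ⟨w, hw, hf⟩
    refine ⟨w0, Or.inl hf0, fun w' hf' => hf'.prefix_of_le hf0 ?_⟩
    rw [hw0]
    exact Nat.le_findGreatest hf'.1 ⟨w', rfl, hf'⟩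
  · exact ⟨[], Or.inr rfl, fun w' hf' => absurd ⟨_, hf'.1, w', rfl, hf'⟩ h⟩

/-- Send `u` to the longest word forced by it. Continuity at a point of the domain makes every
initial segment of the value forced by a long enough initial segment of the argument. -/
theorem IsContinuous.exists_word {F : Baire →. Baire} (hF : IsContinuous F) :
    ∃ φ : List ℕ → List ℕ, WordMono φ ∧ ∀ p q, q ∈ F p → Approximates φ p q := by
  choose φ hφ hmax using exists_forces_max F
  refine ⟨φ, fun u v huv => ?_, fun p q hq n => ?_⟩
  · rcases hφ u with h | h
    · exact hmax v _ (h.mono huv)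
    · rw [h]; exact List.nil_prefix
  · have hp : p ∈ F.Dom := Part.dom_iff_mem.2 ⟨q, hq⟩
    have hv : ∀ s : F.Dom, ∀ q', q' ∈ F s.1 → F.asSubtype s = q' := fun s q' h =>
      PFun.asSubtype_eq_of_mem h s.2
    have hn : F.asSubtype ⁻¹' {q' | initSeg q' (n + 1) = initSeg q (n + 1)} ∈
        nhds (⟨p, hp⟩ : F.Dom) := by
      refine ((isOpen_initSeg q (n + 1)).preimage hF).mem_nhds ?_
      simp [hv ⟨p, hp⟩ q hq]
    rw [nhds_subtype, Filter.mem_comap] at hn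
    obtain ⟨s, hs, hsub⟩ := hn
    obtain ⟨k, hk⟩ := exists_nhds_initSeg p hs
    -- The cylinder needs `k` entries; `n + 1` satisfies the length bound in `Forces`.
    have hf : Forces F (initSeg p (max k (n + 1))) (initSeg q (n + 1)) := by
      refine ⟨by simp, k, by simp, ⟨p, q, hq, (initSeg_take p (le_max_left _ _)).symm⟩, ?_⟩
      intro p' q' hq' h
      rw [initSeg_take p (le_max_left _ _)] at h
      have hp' : p' ∈ F.Dom := Part.dom_iff_mem.2 ⟨q', hq'⟩
      have : (⟨p', hp'⟩ : F.Dom) ∈ (Subtype.val ⁻¹' s : Set F.Dom) := hk p' h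
      have := hsub this
      rw [Set.mem_preimage, hv ⟨p', hp'⟩ q' hq'] at this
      simpa using this
    exact ⟨_, getElem?_of_prefix (hmax _ _ hf) (initSeg_getElem? q n.lt_succ_self)⟩

/-! ### Weihrauch reducibility in terms of word functions -/

/-- Reducibility of `f` to `g` by translations given by functions on words in the class `C`. -/
def WordReducible {X Y : Type*} (C : (List ℕ → List ℕ) → Prop) (δX : Representation X)
    (δY : Representation Y) (f : MultiFun X Y) (g : MultiFun Baire Baire) : Prop :=
  ∃ φ κ : List ℕ → List ℕ, (C φ ∧ WordMono φ) ∧ (C κ ∧ WordMono κ) ∧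
    ∀ p, ∀ x ∈ δX.toPFun p, x ∈ MultiFun.dom f → ∃ a, Approximates κ p a ∧ a ∈ MultiFun.dom g ∧
      ∀ r ∈ g a, ∃ q, Approximates φ (pair p r) q ∧ ∃ y ∈ δY.toPFun q, y ∈ f x

theorem mem_comp_idPair {H K G : Baire →. Baire} {p q : Baire} :
    q ∈ H.comp (idPair (G.comp K)) p ↔ ∃ a ∈ K p, ∃ r ∈ G a, q ∈ H (pair p r) := by
  constructor
  · intro h
    obtain ⟨b, hb, hq⟩ := Part.mem_bind_iff.1 h
    obtain ⟨r, hr, rfl⟩ := (Part.mem_map_iff _).1 hb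
    obtain ⟨a, ha, hr⟩ := Part.mem_bind_iff.1 hr
    exact ⟨a, ha, r, hr, hq⟩
  · rintro ⟨a, ha, r, hr, hq⟩
    exact Part.mem_bind_iff.2 ⟨_, (Part.mem_map_iff _).2 ⟨r, Part.mem_bind_iff.2 ⟨a, ha, hr⟩, rfl⟩,
      hq⟩

theorem isRealizer_baireRep {g : MultiFun Baire Baire} {G : Baire →. Baire} :
    IsRealizer baireRep baireRep g G ↔ ∀ a ∈ MultiFun.dom g, ∃ r ∈ G a, r ∈ g a := by
  simp [IsRealizer, baireRep, PFun.id]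

/-- Quantifying over all realizers of `g` amounts to quantifying over all solutions of the one
instance `a`, since a realizer may take any prescribed solution as its value at `a`. -/
theorem setReducible_iff_wordReducible {X Y : Type*} {δX : Representation X}
    {δY : Representation Y} {f : MultiFun X Y} {g : MultiFun Baire Baire}
    {C : (Baire →. Baire) → Prop} {C' : (List ℕ → List ℕ) → Prop}
    (hC : ∀ F, C F → ∃ φ, C' φ ∧ WordMono φ ∧ ∀ p q, q ∈ F p → Approximates φ p q)
    (hC' : ∀ φ, C' φ → WordMono φ → C (ofWord φ)) :
    SetReducible C {F | IsRealizer δX δY f F} {G | IsRealizer baireRep baireRep g G} ↔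
      WordReducible C' δX δY f g := by
  classical
  constructor
  · rintro ⟨H, K, hH, hK, h⟩
    obtain ⟨φ, hφ, hφm, hφH⟩ := hC H hH
    obtain ⟨κ, hκ, hκm, hκK⟩ := hC K hK
    refine ⟨φ, κ, ⟨hφ, hφm⟩, ⟨hκ, hκm⟩, fun p x hx hxf => ?_⟩
    -- Each choice of solutions is a realizer defined exactly on `MultiFun.dom g`, so definedness of
    -- the composite puts `a` into that domain.
    have key : ∀ c : ∀ a, a ∈ MultiFun.dom g → Baire, (∀ a ha, c a ha ∈ g a) →
        ∃ a ∈ K p, ∃ ha : a ∈ MultiFun.dom g, ∃ q ∈ H (pair p (c a ha)),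
          ∃ y ∈ δY.toPFun q, y ∈ f x := by
      intro c hc
      obtain ⟨F, hF, rfl⟩ := h (fun a => ⟨a ∈ MultiFun.dom g, c a⟩)
        (isRealizer_baireRep.2 fun a ha => ⟨_, ⟨ha, rfl⟩, hc a ha⟩)
      obtain ⟨q, hq, hy⟩ := hF p x hx hxf
      obtain ⟨a, ha, r, ⟨hd, rfl⟩, hq⟩ := mem_comp_idPair.1 hq
      exact ⟨a, ha, hd, q, hq, hy⟩
    obtain ⟨a, ha, hag, -⟩ := key (fun a ha => Set.Nonempty.some (s := g a) ha)
      (fun a ha => Set.Nonempty.some_mem (s := g a) ha)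
    refine ⟨a, hκK p a ha, hag, fun r hr => ?_⟩
    -- The realizer that answers `r` at `a` and an arbitrary solution elsewhere.
    obtain ⟨a', ha', hd, q, hq, hy⟩ := key (fun b hb => if b = a then r else Set.Nonempty.some (s := g b) hb) (by
      intro b hb
      split_ifs with h
      · rwa [h]
      · exact Set.Nonempty.some_mem (s := g b) hb)
    obtain rfl := Part.mem_unique ha' ha
    rw [if_pos rfl] at hq
    exact ⟨q, hφH _ _ hq, hy⟩
  · rintro ⟨φ, κ, ⟨hφ, hφm⟩, ⟨hκ, hκm⟩, h⟩
    refine ⟨ofWord φ, ofWord κ, hC' φ hφ hφm, hC' κ hκ hκm, fun G hG => ⟨_, ?_, rfl⟩⟩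
    intro p x hx hxf
    obtain ⟨a, ha, hag, hr⟩ := h p x hx hxf
    obtain ⟨r, hrG, hrg⟩ := isRealizer_baireRep.1 hG a hag
    obtain ⟨q, hq, hy⟩ := hr r hrg
    exact ⟨q, mem_comp_idPair.2 ⟨a, (mem_ofWord hκm).2 ha, r, hrG, (mem_ofWord hφm).2 hq⟩, hy⟩

theorem weaklyComputable_iff {X Y : Type*} {δX : Representation X} {δY : Representation Y}
    {f : MultiFun X Y} :
    WeaklyComputable δX δY f ↔ WordReducible Computable δX δY f parLLPO :=
  setReducible_iff_wordReducible (fun _ hF => hF) fun _ hc hφ => isComputable_ofWord hφ hc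

theorem weaklyContinuous_iff {X Y : Type*} {δX : Representation X} {δY : Representation Y}
    {f : MultiFun X Y} :
    WeaklyContinuous δX δY f ↔ WordReducible (fun _ => True) δX δY f parLLPO :=
  setReducible_iff_wordReducible
    (fun _ hF => (IsContinuous.exists_word hF).imp fun _ h => ⟨trivial, h⟩)
    fun _ _ hφ => isContinuous_ofWord hφ


/-! ### Splitting and interleaving words -/

theorem initSeg_getD (p : Baire) {k n : ℕ} (h : n < k) : (initSeg p k).getD n 0 = p n := by
  rw [List.getD_eq_getElem?_getD, initSeg_getElem? p h]; rfl

theorem getD_of_prefix {u v : List ℕ} (h : u <+: v) {n : ℕ} (hn : n < u.length) :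
    u.getD n 0 = v.getD n 0 := by
  rw [List.getD_eq_getElem?_getD, List.getD_eq_getElem?_getD,
    getElem?_of_prefix h (List.getElem?_eq_getElem hn), List.getElem?_eq_getElem hn]

theorem map_range_getElem? (f : ℕ → ℕ) {n i : ℕ} (h : i < n) :
    ((List.range n).map f)[i]? = some (f i) := initSeg_getElem? f h

theorem map_range_prefix {f f' : ℕ → ℕ} {n n' : ℕ} (hn : n ≤ n') (hf : ∀ i < n, f i = f' i) :
    (List.range n).map f <+: (List.range n').map f' := by
  have : (List.range n).map f = (List.range n).map f' := initSeg_congr hf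
  rw [this]
  exact initSeg_prefix f' hn

/-- The entries of a word at even positions. -/
def evens (v : List ℕ) : List ℕ := (List.range (v.length / 2)).map fun i => v.getD (2 * i) 0

/-- The entries of a word at odd positions. -/
def odds (v : List ℕ) : List ℕ := (List.range (v.length / 2)).map fun i => v.getD (2 * i + 1) 0

/-- The interleaving of two words. -/
def interleave (u w : List ℕ) : List ℕ :=
  (List.range (2 * min u.length w.length)).map fun j =>
    bif j % 2 == 0 then u.getD (j / 2) 0 else w.getD (j / 2) 0

theorem wordMono_evens : WordMono evens := fun u v h =>
  map_range_prefix (Nat.div_le_div_right h.length_le) fun i hi => getD_of_prefix h (by omega)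

theorem wordMono_odds : WordMono odds := fun u v h =>
  map_range_prefix (Nat.div_le_div_right h.length_le) fun i hi => getD_of_prefix h (by omega)

theorem interleave_mono {u u' w w' : List ℕ} (hu : u <+: u') (hw : w <+: w') :
    interleave u w <+: interleave u' w' := by
  have := hu.length_le
  have := hw.length_le
  refine map_range_prefix (by omega) fun i hi => ?_
  rw [getD_of_prefix hu (by omega), getD_of_prefix hw (by omega)]

theorem pair_even (p q : Baire) (n : ℕ) : pair p q (2 * n) = p n := by
  simp [pair]

theorem pair_odd (p q : Baire) (n : ℕ) : pair p q (2 * n + 1) = q n := by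
  have h : (2 * n + 1) / 2 = n := by omega
  have h' : (2 * n + 1) % 2 = 1 := by omega
  simp [pair, h, h']

theorem approximates_evens (p q : Baire) : Approximates evens (pair p q) p := by
  intro n
  -- Only complete pairs of entries count, so position `2 * n` alone is not enough.
  refine ⟨2 * n + 2, ?_⟩
  rw [evens, map_range_getElem? _ (by rw [initSeg_length]; omega), initSeg_getD _ (by omega),
    pair_even]

theorem approximates_odds (p q : Baire) : Approximates odds (pair p q) q := by
  intro n
  refine ⟨2 * n + 2, ?_⟩
  rw [odds, map_range_getElem? _ (by rw [initSeg_length]; omega), initSeg_getD _ (by omega),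
    pair_odd]

theorem WordMono.interleave {φ ψ : List ℕ → List ℕ} (hφ : WordMono φ) (hψ : WordMono ψ) :
    WordMono (fun u => interleave (φ u) (ψ u)) :=
  fun u v h => interleave_mono (hφ u v h) (hψ u v h)

theorem Approximates.interleave {φ ψ : List ℕ → List ℕ} {p q r : Baire} (hφ : WordMono φ)
    (hψ : WordMono ψ) (hq : Approximates φ p q) (hr : Approximates ψ p r) :
    Approximates (fun u => interleave (φ u) (ψ u)) p (pair q r) := by
  intro n
  obtain ⟨k, hk⟩ := hq.exists_prefix hφ (n + 1)
  obtain ⟨l, hl⟩ := hr.exists_prefix hψ (n + 1)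
  refine ⟨max k l, getElem?_of_prefix (interleave_mono
    (hk.trans (hφ.initSeg p (le_max_left k l))) (hl.trans (hψ.initSeg p (le_max_right k l)))) ?_⟩
  rw [Weihrauch.interleave, map_range_getElem? _ (by simp only [initSeg_length]; omega),
    initSeg_getD _ (by omega), initSeg_getD _ (by omega)]
  rw [pair, Bool.cond_eq_ite]
  simp only [beq_iff_eq]

/-! ### Dead nodes of the binary tree -/

/-- Binary words of length `n`. -/
def binWords : ℕ → List (List ℕ)
  | 0 => [[]]
  | n + 1 => (binWords n).flatMap fun w => [0 :: w, 1 :: w]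

theorem mem_binWords {n : ℕ} {w : List ℕ} :
    w ∈ binWords n ↔ w.length = n ∧ ∀ x ∈ w, x < 2 := by
  induction n generalizing w with
  | zero => simp +contextual [binWords]
  | succ n ih =>
    rcases w with _ | ⟨x, w⟩
    · simp [binWords]
    · simp only [binWords, List.mem_flatMap, ih, List.mem_cons, List.cons.injEq, List.not_mem_nil,
        or_false, List.length_cons, Nat.add_right_cancel_iff, forall_eq_or_imp]
      constructor
      · rintro ⟨v, ⟨h1, h2⟩, ⟨rfl, rfl⟩ | ⟨rfl, rfl⟩⟩ <;>
          exact ⟨h1, by omega, h2⟩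
      · rintro ⟨h1, h2, h3⟩
        exact ⟨w, ⟨h1, h3⟩, by simp only [and_true]; omega⟩

/-- A decidable relation on words that persists under extension of both words. -/
def Persistent (B : List ℕ → List ℕ → Bool) : Prop :=
  ∀ u u' w w', u <+: u' → w <+: w' → B u w = true → B u' w' = true

/-- All binary extensions of `σ` by `u.length` entries satisfy `B u`. -/
def dead (B : List ℕ → List ℕ → Bool) (u σ : List ℕ) : Bool :=
  (binWords u.length).all fun w => B u (σ ++ w)

theorem dead_eq_true {B : List ℕ → List ℕ → Bool} {u σ : List ℕ} :
    dead B u σ = true ↔ ∀ w, w.length = u.length → (∀ x ∈ w, x < 2) → B u (σ ++ w) = true := by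
  simp only [dead, List.all_eq_true, mem_binWords, and_imp]

theorem dead_mono {B : List ℕ → List ℕ → Bool} (hB : Persistent B) {u u' σ : List ℕ}
    (h : u <+: u') (hd : dead B u σ = true) : dead B u' σ = true := by
  rw [dead_eq_true] at hd ⊢
  intro w hw hw2
  refine hB _ _ _ _ h ?_ (hd (w.take u.length) ?_ fun x hx => hw2 x (List.mem_of_mem_take hx))
  · exact (List.prefix_append_right_inj σ).2 (List.take_prefix _ _)
  · rw [List.length_take, hw, min_eq_left h.length_le]

theorem dead_of_rel {B : List ℕ → List ℕ → Bool} (hB : Persistent B) {u σ : List ℕ}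
    (h : B u σ = true) : dead B u σ = true :=
  dead_eq_true.2 fun _ _ _ => hB _ _ _ _ List.prefix_rfl (List.prefix_append _ _) h

/-- An extension by `k + 1` entries is a child followed by `k` entries, so the parent dies at most
one stage after both children. -/
theorem dead_of_children {B : List ℕ → List ℕ → Bool} (hB : Persistent B) {p : Baire} {k : ℕ}
    {σ : List ℕ} (h : ∀ b < 2, dead B (initSeg p k) (σ ++ [b]) = true) :
    dead B (initSeg p (k + 1)) σ = true := by
  rw [dead_eq_true]
  rintro (_ | ⟨b, w⟩) hw hw2
  · simp at hw
  · have hb := dead_eq_true.1 (h b (hw2 b (by simp))) w (by simpa using hw)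
      fun x hx => hw2 x (List.mem_cons_of_mem _ hx)
    rw [List.append_assoc] at hb
    exact hB _ _ _ _ (initSeg_prefix p k.le_succ) List.prefix_rfl hb

/-! ### One instance of `LLPO` for each node -/

/-- At stage `u`, the child of the `i`-th word given by the parity of `m` is dead and its sibling
is not. -/
def deadChild (B : List ℕ → List ℕ → Bool) (u : List ℕ) (i m : ℕ) : Bool :=
  dead B u (Denumerable.ofNat (List ℕ) i ++ [m % 2]) &&
    !dead B u (Denumerable.ofNat (List ℕ) i ++ [1 - m % 2])

/-- Indicates the first stage at which exactly one child of the `i`-th word is seen to be dead, with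
the child given by the parity of the stage. -/
def llpoEntry (B : List ℕ → List ℕ → Bool) (u : List ℕ) (i m : ℕ) : ℕ :=
  bif deadChild B (u.take m) i m && (List.range m).all fun m' => !deadChild B (u.take m') i m'
  then 1 else 0

/-- The sequence of instances of `LLPO`, one for each word, whose solutions lead along the nodes
without dead stage. -/
def llpoWord (B : List ℕ → List ℕ → Bool) (u : List ℕ) : List ℕ :=
  (List.range u.length).map fun j => llpoEntry B u j.unpair.1 j.unpair.2

/-- Only stages up to `m` are inspected. As `j.unpair.2 ≤ j`, the output entry at `j` depends on the
first `j` input entries only, whence monotonicity of `llpoWord`. -/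
theorem llpoEntry_congr (B : List ℕ → List ℕ → Bool) {u v : List ℕ} (h : u <+: v) {i m : ℕ}
    (hm : m ≤ u.length) : llpoEntry B u i m = llpoEntry B v i m := by
  have key : ∀ k ≤ m, u.take k = v.take k := fun k hk => by
    obtain ⟨t, rfl⟩ := h
    rw [List.take_append_of_le_length (hk.trans hm)]
  have : ∀ {f g : ℕ → Bool}, (∀ k < m, f k = g k) → (List.range m).all f = (List.range m).all g := by
    intro f g hfg
    rw [Bool.eq_iff_iff]
    simp only [List.all_eq_true, List.mem_range]
    exact forall₂_congr fun k hk => by rw [hfg k hk]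
  rw [llpoEntry, llpoEntry, key m le_rfl, this fun k hk => by rw [key k hk.le]]

theorem wordMono_llpoWord (B : List ℕ → List ℕ → Bool) : WordMono (llpoWord B) := fun _ _ h =>
  map_range_prefix h.length_le fun j hj =>
    llpoEntry_congr B h ((Nat.unpair_right_le j).trans hj.le)

theorem approximates_llpoWord (B : List ℕ → List ℕ → Bool) (p : Baire) :
    Approximates (llpoWord B) p
      fun j => llpoEntry B (initSeg p j) j.unpair.1 j.unpair.2 := by
  intro n
  refine ⟨n + 1, ?_⟩
  rw [llpoWord, map_range_getElem? _ (by simp),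
    ← llpoEntry_congr B (initSeg_prefix p n.le_succ) (by simpa using Nat.unpair_right_le n)]

theorem llpoEntry_ne_zero {B : List ℕ → List ℕ → Bool} {p : Baire} {k i m : ℕ} (h : m ≤ k) :
    llpoEntry B (initSeg p k) i m ≠ 0 ↔ deadChild B (initSeg p m) i m = true ∧
      ∀ m' < m, deadChild B (initSeg p m') i m' = false := by
  have : ∀ k' < m, initSeg p k' = (initSeg p k).take k' := fun k' hk' =>
    (initSeg_take p (by omega)).symm
  rw [llpoEntry, initSeg_take p h]
  simp only [ne_eq, Bool.cond_eq_ite, ite_eq_right_iff, one_ne_zero, imp_false, not_not,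
    Bool.and_eq_true, List.all_eq_true, List.mem_range, Bool.not_eq_true']
  refine and_congr_right fun _ => forall₂_congr fun m' hm' => ?_
  rw [initSeg_take p (by omega)]

/-- Uniform form of both cases of `LLPO`: an answer excludes nonzero entries at positions of its own
parity. Hence a nonzero entry at stage `m` rules out the child `m % 2`. -/
theorem mem_parLLPO {a r : Baire} : r ∈ parLLPO a ↔
    (∀ i k l, a (Nat.pair i k) ≠ 0 → a (Nat.pair i l) ≠ 0 → k = l) ∧
      ∀ i, r i < 2 ∧ ∀ m, r i = m % 2 → a (Nat.pair i m) = 0 := by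
  simp only [parLLPO, parallelization, LLPO, untuple, Set.mem_ofPred_eq]
  rw [forall_and]
  refine and_congr_right fun _ => forall_congr' fun i => ?_
  constructor
  · rintro (⟨h, h'⟩ | ⟨h, h'⟩)
    · refine ⟨by omega, fun m hm => ?_⟩
      obtain ⟨n, rfl⟩ : ∃ n, m = 2 * n := ⟨m / 2, by omega⟩
      exact h' n
    · refine ⟨by omega, fun m hm => ?_⟩
      obtain ⟨n, rfl⟩ : ∃ n, m = 2 * n + 1 := ⟨m / 2, by omega⟩
      exact h' n
  · rintro ⟨h, h'⟩
    obtain h0 | h1 : r i = 0 ∨ r i = 1 := by omega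
    · exact Or.inl ⟨h0, fun n => h' _ (by omega)⟩
    · exact Or.inr ⟨h1, fun n => h' _ (by omega)⟩

theorem mem_dom_parLLPO {a : Baire}
    (h : ∀ i k l, a (Nat.pair i k) ≠ 0 → a (Nat.pair i l) ≠ 0 → k = l) :
    a ∈ MultiFun.dom parLLPO := by
  classical
  refine ⟨fun i => if ∀ n, a (Nat.pair i (2 * n)) = 0 then 0 else 1, mem_parLLPO.2 ⟨h, fun i => ?_⟩⟩
  split_ifs with h0
  · refine ⟨by omega, fun m hm => ?_⟩
    obtain ⟨n, rfl⟩ : ∃ n, m = 2 * n := ⟨m / 2, by omega⟩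
    exact h0 n
  · refine ⟨by omega, fun m hm => ?_⟩
    push Not at h0
    obtain ⟨n, hn⟩ := h0
    by_contra hne
    have := h i _ _ hn hne
    omega

/-! ### Following the answers through the tree -/

/-- One step of the walk along the answers in `v`. -/
def walkStep (v w : List ℕ) : List ℕ := w ++ (v[Encodable.encode w]?).toList

/-- The walk that extends a word `w` by the answer stored in `v` at the code of `w`. -/
def walkFrom (v : List ℕ) (k : ℕ) : List ℕ := Nat.rec [] (fun _ w => walkStep v w) k

/-- The walk along the answers in `v`, as long as they are available. -/
def walk (v : List ℕ) : List ℕ := walkFrom v v.length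

theorem walkFrom_succ (v : List ℕ) (k : ℕ) : walkFrom v (k + 1) = walkStep v (walkFrom v k) := rfl

theorem walkFrom_prefix (v : List ℕ) {k l : ℕ} (h : k ≤ l) : walkFrom v k <+: walkFrom v l := by
  induction l, h using Nat.le_induction with
  | base => exact List.prefix_rfl
  | succ l _ ih => exact ih.trans (List.prefix_append _ _)

theorem walkFrom_mono {v v' : List ℕ} (h : v <+: v') (k : ℕ) :
    walkFrom v k <+: walkFrom v' k := by
  -- The induction needs the reason for a difference: the walk along `v` is stuck at a missing
  -- answer and stays there while the walk along `v'` may go on.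
  suffices walkFrom v k = walkFrom v' k ∨
      (walkFrom v k <+: walkFrom v' k ∧ v[Encodable.encode (walkFrom v k)]? = none) by
    rcases this with h | h
    · rw [h]
    · exact h.1
  induction k with
  | zero => exact Or.inl rfl
  | succ k ih =>
    rw [walkFrom_succ, walkFrom_succ]
    by_cases hn : v[Encodable.encode (walkFrom v k)]? = none
    · have hs : walkStep v (walkFrom v k) = walkFrom v k := by simp [walkStep, hn]
      rw [hs]
      refine Or.inr ⟨?_, hn⟩
      rcases ih with ih | ih
      · rw [ih]; exact List.prefix_append _ _
      · exact ih.1.trans (List.prefix_append _ _)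
    · rcases ih with ih | ih
      · obtain ⟨b, hb⟩ := Option.ne_none_iff_exists'.1 hn
        left
        rw [walkStep, hb, walkStep, ← ih, getElem?_of_prefix h hb]
      · exact absurd ih.2 hn

theorem wordMono_walk : WordMono walk := fun _ v h =>
  (walkFrom_mono h _).trans (walkFrom_prefix v h.length_le)

/-- The infinite walk along the answers in `t`. -/
def walkNode (t : Baire) (k : ℕ) : List ℕ :=
  Nat.rec [] (fun _ w => w ++ [t (Encodable.encode w)]) k

theorem walkNode_succ (t : Baire) (k : ℕ) :
    walkNode t (k + 1) = walkNode t k ++ [t (Encodable.encode (walkNode t k))] := rfl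

/-- The path traced by the infinite walk along the answers in `t`. -/
def walkPath (t : Baire) : Baire := fun k => t (Encodable.encode (walkNode t k))

theorem initSeg_walkPath (t : Baire) (k : ℕ) : initSeg (walkPath t) k = walkNode t k := by
  induction k with
  | zero => rfl
  | succ k ih => rw [initSeg_succ, ih, walkNode_succ, walkPath]

theorem approximates_walk (t : Baire) : Approximates walk t (walkPath t) := by
  have key : ∀ n, ∃ N, ∀ k ≥ N, walkFrom (initSeg t k) n = walkNode t n := by
    intro n
    induction n with
    | zero => exact ⟨0, fun _ _ => rfl⟩
    | succ n ih =>
      obtain ⟨N, hN⟩ := ih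
      -- The answer at a node sits at the node's code, which must lie within the known part of `t`.
      refine ⟨max N (Encodable.encode (walkNode t n) + 1), fun k hk => ?_⟩
      rw [walkFrom_succ, hN k (by omega), walkStep, initSeg_getElem? t (by omega), walkNode_succ]
      rfl
  intro n
  obtain ⟨N, hN⟩ := key (n + 1)
  refine ⟨max N (n + 1), getElem?_of_prefix (walkFrom_prefix _ (k := n + 1) ?_) ?_⟩
  · simp
  · rw [hN _ (le_max_left _ _), ← initSeg_walkPath, initSeg_getElem? _ n.lt_succ_self]

/-! ### Weak Kőnig's lemma -/

/-- Weak Kőnig's lemma reduces to parallelized `LLPO`: if some binary path avoids `B`, then the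
solutions of the instances `llpoWord B` lead along such paths. -/
theorem exists_path_of_parLLPO {B : List ℕ → List ℕ → Bool} (hB : Persistent B) {p : Baire}
    (hp : ∃ τ : Baire, (∀ n, τ n < 2) ∧ ∀ k l, B (initSeg p k) (initSeg τ l) = false) :
    ∃ a, Approximates (llpoWord B) p a ∧ a ∈ MultiFun.dom parLLPO ∧
      ∀ t ∈ parLLPO a, (∀ n, walkPath t n < 2) ∧
        ∀ k l, B (initSeg p k) (initSeg (walkPath t) l) = false := by
  set a : Baire := fun j => llpoEntry B (initSeg p j) j.unpair.1 j.unpair.2 with ha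
  have hne : ∀ i m, a (Nat.pair i m) ≠ 0 ↔ deadChild B (initSeg p m) i m = true ∧
      ∀ m' < m, deadChild B (initSeg p m') i m' = false := by
    intro i m
    simp only [ha, Nat.unpair_pair]
    exact llpoEntry_ne_zero (Nat.right_le_pair i m)
  refine ⟨a, approximates_llpoWord B p, mem_dom_parLLPO fun i k l hk hl => ?_, fun t ht => ?_⟩
  · rw [hne] at hk hl
    rcases lt_trichotomy k l with h | h | h
    · exact absurd hk.1 (by simp [hl.2 k h])
    · exact h
    · exact absurd hl.1 (by simp [hk.2 l h])
  · obtain ⟨-, ht⟩ := mem_parLLPO.1 ht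
    refine ⟨fun n => (ht _).1, ?_⟩
    have alive : ∀ l k, dead B (initSeg p k) (walkNode t l) = false := by
      intro l
      induction l with
      | zero =>
        intro k
        -- The root never dies: at stage `k` the first `k` entries of `τ` are an extension that is
        -- not refuted.
        obtain ⟨τ, hτ, h⟩ := hp
        rw [Bool.eq_false_iff]
        intro hd
        have := dead_eq_true.1 hd (initSeg τ k) (by simp) (by
          simp only [initSeg, List.mem_map, List.mem_range]
          rintro _ ⟨j, -, rfl⟩
          exact hτ j)
        rw [show walkNode t 0 = [] from rfl, List.nil_append, h] at this
        exact Bool.false_ne_true this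
      | succ l ih =>
        intro k
        rw [walkNode_succ]
        set σ := walkNode t l with hσ
        set i := Encodable.encode σ with hi
        have hiσ : Denumerable.ofNat (List ℕ) i = σ := by rw [hi, Denumerable.ofNat_encode]
        obtain ⟨hb, hz⟩ := ht i
        rw [Bool.eq_false_iff]
        intro hd
        -- If the chosen child dies, the sibling never does, for otherwise the parent `σ` would die
        -- too.
        have sib : ∀ k', dead B (initSeg p k') (σ ++ [1 - t i]) = false := by
          intro k'
          rw [Bool.eq_false_iff]
          intro hd'
          refine Bool.eq_false_iff.1 (ih (max k k' + 1)) (dead_of_children hB fun b hb2 => ?_)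
          obtain rfl | rfl : b = t i ∨ b = 1 - t i := by omega
          · exact dead_mono hB (initSeg_prefix p (le_max_left _ _)) hd
          · exact dead_mono hB (initSeg_prefix p (le_max_right _ _)) hd'
        -- Deadness persists, so it can be reported at a later stage of the parity that names the
        -- child: `2 * k + t i` is at least `k` and congruent to `t i`.
        have hex : ∃ m, deadChild B (initSeg p m) i m = true := by
          refine ⟨2 * k + t i, ?_⟩
          rw [deadChild, hiσ, show (2 * k + t i) % 2 = t i by omega, sib,
            dead_mono hB (initSeg_prefix p (by omega)) hd]
          rfl
        classical
        have hspec := Nat.find_spec hex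
        have hmin : ∀ m' < Nat.find hex, deadChild B (initSeg p m') i m' = false := fun m' hm' =>
          Bool.eq_false_iff.2 (Nat.find_min hex hm')
        refine (hne i _).2 ⟨hspec, hmin⟩ (hz _ ?_)
        -- The first report cannot name the sibling, which never dies; so it names the child `t i`,
        -- contradicting the answer `t i`.
        by_contra hpar
        rw [deadChild, hiσ, show Nat.find hex % 2 = 1 - t i by omega, sib] at hspec
        exact Bool.false_ne_true hspec
    intro k l
    rw [initSeg_walkPath, Bool.eq_false_iff]
    intro h
    exact Bool.eq_false_iff.1 (alive l k) (dead_of_rel hB h)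

/-! ### Two consecutive instances as one closed condition -/

/-- Some component of the word `r` is seen not to solve the instance of `LLPO` given by `a`. -/
def conflict (a r : List ℕ) : Bool :=
  (List.range a.length).any fun j =>
    !(a.getD j 0 == 0) && decide (r[j.unpair.1]? = some (j.unpair.2 % 2))

theorem conflict_eq_true {a r : List ℕ} : conflict a r = true ↔
    ∃ j < a.length, a.getD j 0 ≠ 0 ∧ r[j.unpair.1]? = some (j.unpair.2 % 2) := by
  simp [conflict]

theorem conflict_mono : Persistent conflict := by
  intro a a' r r' ha hr h
  rw [conflict_eq_true] at h ⊢
  obtain ⟨j, hj, h1, h2⟩ := h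
  exact ⟨j, hj.trans_le ha.length_le, by rwa [← getD_of_prefix ha hj], getElem?_of_prefix hr h2⟩

theorem conflict_eq_false {a r : Baire} (h : r ∈ parLLPO a) {u w : List ℕ} {k l : ℕ}
    (hu : u <+: initSeg a k) (hw : w <+: initSeg r l) : conflict u w = false := by
  rw [Bool.eq_false_iff]
  intro hc
  obtain ⟨j, hj, h1, h2⟩ := conflict_eq_true.1 (conflict_mono _ _ _ _ hu hw hc)
  rw [initSeg_length] at hj
  rw [initSeg_getD _ hj] at h1
  have := ((mem_parLLPO.1 h).2 _).2 _ (initSeg_getElem?_eq_some.1 h2).2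
  rw [Nat.pair_unpair] at this
  exact h1 this

/-- Solutions form a closed set: a wrong component is exposed by one nonzero entry of `a` and one
entry of `r`. Uniqueness of nonzero entries is not tested and comes from `ha`. -/
theorem mem_parLLPO_of_conflict {a r : Baire} (ha : a ∈ MultiFun.dom parLLPO) (hr : ∀ n, r n < 2)
    (h : ∀ k l, conflict (initSeg a k) (initSeg r l) = false) : r ∈ parLLPO a := by
  obtain ⟨r', hr'⟩ := ha
  refine mem_parLLPO.2 ⟨(mem_parLLPO.1 hr').1, fun i => ⟨hr i, fun m hm => ?_⟩⟩
  by_contra hne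
  refine Bool.eq_false_iff.1 (h (Nat.pair i m + 1) (i + 1))
    (conflict_eq_true.2 ⟨Nat.pair i m, by simp, ?_, ?_⟩)
  · rwa [initSeg_getD _ (Nat.lt_succ_self _)]
  · rw [Nat.unpair_pair, initSeg_getElem? _ (Nat.lt_succ_self _), hm]

/-- The word `w`, read as a pair of words, is seen not to solve two consecutive instances of
parallelized `LLPO`, the second of which depends on the solution of the first. -/
def bad (κ₁ φ₁ κ₂ : List ℕ → List ℕ) (u w : List ℕ) : Bool :=
  conflict (κ₁ u) (evens w) || conflict (κ₂ (φ₁ (interleave u (evens w)))) (odds w)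

theorem persistent_bad {κ₁ φ₁ κ₂ : List ℕ → List ℕ} (hκ₁ : WordMono κ₁) (hφ₁ : WordMono φ₁)
    (hκ₂ : WordMono κ₂) : Persistent (bad κ₁ φ₁ κ₂) := by
  intro u u' w w' hu hw h
  rw [bad, Bool.or_eq_true] at h ⊢
  have he := wordMono_evens _ _ hw
  exact h.imp (conflict_mono _ _ _ _ (hκ₁ _ _ hu) he)
    (conflict_mono _ _ _ _ (hκ₂ _ _ (hφ₁ _ _ (interleave_mono hu he))) (wordMono_odds _ _ hw))

/-- The output translation for a composition. -/
def compOut (φ₁ φ₂ : List ℕ → List ℕ) (v : List ℕ) : List ℕ :=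
  φ₂ (interleave (φ₁ (interleave (evens v) (evens (walk (odds v))))) (odds (walk (odds v))))

theorem pair_evens_odds (τ : Baire) : pair (fun n => τ (2 * n)) (fun n => τ (2 * n + 1)) = τ := by
  funext n
  unfold pair
  split_ifs <;> exact congrArg τ (by omega)

theorem evens_initSeg (τ : Baire) (l : ℕ) :
    evens (initSeg τ l) = initSeg (fun n => τ (2 * n)) (l / 2) := by
  rw [evens, initSeg_length]
  exact initSeg_congr fun n hn => initSeg_getD τ (by omega)

theorem odds_initSeg (τ : Baire) (l : ℕ) :
    odds (initSeg τ l) = initSeg (fun n => τ (2 * n + 1)) (l / 2) := by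
  rw [odds, initSeg_length]
  exact initSeg_congr fun n hn => initSeg_getD τ (by omega)

theorem interleave_initSeg (p r : Baire) (k l : ℕ) :
    interleave (initSeg p k) (initSeg r l) = initSeg (pair p r) (2 * min k l) := by
  rw [interleave, initSeg_length, initSeg_length]
  refine initSeg_congr fun n hn => ?_
  rw [initSeg_getD p (by omega), initSeg_getD r (by omega), pair, Bool.cond_eq_ite]
  simp only [beq_iff_eq]

theorem bad_initSeg (κ₁ φ₁ κ₂ : List ℕ → List ℕ) (p r s : Baire) (k l : ℕ) :
    bad κ₁ φ₁ κ₂ (initSeg p k) (initSeg (pair r s) l) =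
      (conflict (κ₁ (initSeg p k)) (initSeg r (l / 2)) ||
        conflict (κ₂ (φ₁ (initSeg (pair p r) (2 * min k (l / 2))))) (initSeg s (l / 2))) := by
  simp only [bad, evens_initSeg, odds_initSeg, interleave_initSeg, pair_even, pair_odd]

/-- The words that `bad` computes from initial segments are prefixes of the true instances `a` and
`b`, and these do not conflict with their solutions. -/
theorem bad_eq_false {κ₁ φ₁ κ₂ : List ℕ → List ℕ} (hκ₁ : WordMono κ₁) (hφ₁ : WordMono φ₁)
    (hκ₂ : WordMono κ₂) {p a r q b s : Baire} (ha : Approximates κ₁ p a) (hr : r ∈ parLLPO a)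
    (hq : Approximates φ₁ (pair p r) q) (hb : Approximates κ₂ q b) (hs : s ∈ parLLPO b) (k l : ℕ) :
    bad κ₁ φ₁ κ₂ (initSeg p k) (initSeg (pair r s) l) = false := by
  rw [bad_initSeg, Bool.or_eq_false_iff]
  obtain ⟨n, hn⟩ := ha.prefix_initSeg hκ₁ k
  obtain ⟨m, hm⟩ := (hb.comp hκ₂ hφ₁ hq).prefix_initSeg (hκ₂.comp hφ₁) (2 * min k (l / 2))
  exact ⟨conflict_eq_false hr hn List.prefix_rfl, conflict_eq_false hs hm List.prefix_rfl⟩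

theorem mem_parLLPO_of_bad_left {κ₁ φ₁ κ₂ : List ℕ → List ℕ} (hκ₁ : WordMono κ₁)
    {p a r s : Baire} (ha : Approximates κ₁ p a) (had : a ∈ MultiFun.dom parLLPO)
    (hr : ∀ n, r n < 2)
    (h : ∀ k l, bad κ₁ φ₁ κ₂ (initSeg p k) (initSeg (pair r s) l) = false) : r ∈ parLLPO a := by
  refine mem_parLLPO_of_conflict had hr fun k l => ?_
  obtain ⟨k', hk'⟩ := ha.exists_prefix hκ₁ k
  have h' := h k' (2 * l)
  rw [bad_initSeg, Bool.or_eq_false_iff] at h'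
  rw [Bool.eq_false_iff] at h' ⊢
  exact fun hc => h'.1 (conflict_mono _ _ _ _ hk' (initSeg_prefix r (by omega)) hc)

theorem mem_parLLPO_of_bad_right {κ₁ φ₁ κ₂ : List ℕ → List ℕ} (hφ₁ : WordMono φ₁)
    (hκ₂ : WordMono κ₂) {p r q b s : Baire} (hq : Approximates φ₁ (pair p r) q)
    (hb : Approximates κ₂ q b) (hbd : b ∈ MultiFun.dom parLLPO) (hs : ∀ n, s n < 2)
    (h : ∀ k l, bad κ₁ φ₁ κ₂ (initSeg p k) (initSeg (pair r s) l) = false) : s ∈ parLLPO b := by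
  refine mem_parLLPO_of_conflict hbd hs fun k l => ?_
  obtain ⟨k', hk'⟩ := (hb.comp hκ₂ hφ₁ hq).exists_prefix (hκ₂.comp hφ₁) k
  -- Half of this length is at least `k'`, so that `k'` entries of `pair p r` are available to
  -- produce `k` entries of `b`, and at least `l`, so that enough of `s` is seen.
  have h' := h k' (2 * max k' l)
  rw [bad_initSeg, Bool.or_eq_false_iff] at h'
  rw [Bool.eq_false_iff, Bool.eq_false_iff] at h'
  rw [Bool.eq_false_iff]
  refine fun hc => h'.2 (conflict_mono _ _ _ _ (hk'.trans ?_) (initSeg_prefix s (by omega)) hc)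
  exact (hκ₂.comp hφ₁).initSeg _ (by omega)

theorem wordMono_compOut {φ₁ φ₂ : List ℕ → List ℕ} (hφ₁ : WordMono φ₁) (hφ₂ : WordMono φ₂) :
    WordMono (compOut φ₁ φ₂) := by
  have hw := wordMono_walk.comp wordMono_odds
  exact hφ₂.comp ((hφ₁.comp (wordMono_evens.interleave (wordMono_evens.comp hw))).interleave
    (wordMono_odds.comp hw))

theorem approximates_compOut {φ₁ φ₂ : List ℕ → List ℕ} (hφ₁ : WordMono φ₁) (hφ₂ : WordMono φ₂)
    {p t r s q z : Baire} (ht : walkPath t = pair r s) (hq : Approximates φ₁ (pair p r) q)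
    (hz : Approximates φ₂ (pair q s) z) : Approximates (compOut φ₁ φ₂) (pair p t) z := by
  have hw := wordMono_walk.comp wordMono_odds
  have aw : Approximates (fun v => walk (odds v)) (pair p t) (pair r s) := by
    rw [← ht]
    exact (approximates_walk t).comp wordMono_walk wordMono_odds (approximates_odds p t)
  have ar := (approximates_evens r s).comp wordMono_evens hw aw
  have as := (approximates_odds r s).comp wordMono_odds hw aw
  have hmr := wordMono_evens.comp hw
  have apr := (approximates_evens p t).interleave wordMono_evens hmr ar
  have aq := hq.comp hφ₁ (wordMono_evens.interleave hmr) apr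
  have hmq := hφ₁.comp (wordMono_evens.interleave hmr)
  have hms := wordMono_odds.comp hw
  have := hz.comp hφ₂ (hmq.interleave hms) (aq.interleave hmq hms as)
  exact this

theorem WordReducible.comp {X Y Z : Type*} {C : (List ℕ → List ℕ) → Prop}
    {δX : Representation X} {δY : Representation Y} {δZ : Representation Z}
    {f : MultiFun X Y} {g : MultiFun Y Z}
    (hK : ∀ κ₁ φ₁ κ₂, C κ₁ → C φ₁ → C κ₂ → C (llpoWord (bad κ₁ φ₁ κ₂)))
    (hH : ∀ φ₁ φ₂, C φ₁ → C φ₂ → C (compOut φ₁ φ₂))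
    (hf : WordReducible C δX δY f parLLPO) (hg : WordReducible C δY δZ g parLLPO) :
    WordReducible C δX δZ (MultiFun.comp g f) parLLPO := by
  obtain ⟨φ₁, κ₁, ⟨cφ₁, hφ₁⟩, ⟨cκ₁, hκ₁⟩, hf⟩ := hf
  obtain ⟨φ₂, κ₂, ⟨cφ₂, hφ₂⟩, ⟨cκ₂, hκ₂⟩, hg⟩ := hg
  refine ⟨compOut φ₁ φ₂, llpoWord (bad κ₁ φ₁ κ₂), ⟨hH _ _ cφ₁ cφ₂, wordMono_compOut hφ₁ hφ₂⟩,
    ⟨hK _ _ _ cκ₁ cφ₁ cκ₂, wordMono_llpoWord _⟩, fun p x hx hxd => ?_⟩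
  obtain ⟨_, hfg, y₀, hy₀, -⟩ := hxd
  obtain ⟨a, ha, had, hfa⟩ := hf p x hx ⟨y₀, hy₀⟩
  -- An avoiding path exists because the two instances can be solved one after the other; the second
  -- is defined for every solution of the first, since `f x` lies in the domain of `g`.
  have hpath : ∃ τ : Baire, (∀ n, τ n < 2) ∧
      ∀ k l, bad κ₁ φ₁ κ₂ (initSeg p k) (initSeg τ l) = false := by
    obtain ⟨r, hr⟩ := had
    obtain ⟨q, hq, y, hy, hyf⟩ := hfa r hr
    obtain ⟨b, hb, ⟨s, hs⟩, -⟩ := hg q y hy (hfg hyf)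
    refine ⟨pair r s, fun n => ?_, bad_eq_false hκ₁ hφ₁ hκ₂ ha hr hq hb hs⟩
    unfold pair
    split_ifs
    · exact ((mem_parLLPO.1 hr).2 _).1
    · exact ((mem_parLLPO.1 hs).2 _).1
  obtain ⟨c, hc, hcd, hct⟩ := exists_path_of_parLLPO (persistent_bad hκ₁ hφ₁ hκ₂) hpath
  refine ⟨c, hc, hcd, fun t ht => ?_⟩
  obtain ⟨h2, hbad⟩ := hct t ht
  rw [← pair_evens_odds (walkPath t)] at hbad
  -- The order matters: `q` and `b` are known to exist only once the even half of the path is known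
  -- to solve `a`.
  have hr := mem_parLLPO_of_bad_left hκ₁ ha had (fun n => h2 (2 * n)) hbad
  obtain ⟨q, hq, y, hy, hyf⟩ := hfa _ hr
  obtain ⟨b, hb, hbd, hgb⟩ := hg q y hy (hfg hyf)
  have hs := mem_parLLPO_of_bad_right hφ₁ hκ₂ hq hb hbd (fun n => h2 (2 * n + 1)) hbad
  obtain ⟨z, hz, w, hw, hwg⟩ := hgb _ hs
  exact ⟨z, approximates_compOut hφ₁ hφ₂ (pair_evens_odds _).symm hq hz, w, hw, hfg, y, hyf, hwg⟩


/-! ### Computability of the translations -/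

section Computability

variable {α β : Type*} [Primcodable α] [Primcodable β]

theorem computable_map_range {f : α → ℕ → β} {n : α → ℕ} (hn : Computable n)
    (hf : Computable₂ f) : Computable fun a => (List.range (n a)).map (f a) := by
  have h : Computable₂ fun (a : α) (x : ℕ × List β) => x.2 ++ [f a x.1] :=
    Computable.list_concat.comp₂ (Computable.snd.comp Computable.snd).to₂
      (hf.comp Computable.fst (Computable.fst.comp Computable.snd)).to₂
  refine (Computable.nat_rec hn (Computable.const []) h).of_eq fun a => ?_
  induction n a with
  | zero => rfl
  | succ k ih => rw [List.range_succ, List.map_append, ← ih]; rfl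

theorem computable_all_range {p : α → ℕ → Bool} {n : α → ℕ} (hn : Computable n)
    (hp : Computable₂ p) : Computable fun a => (List.range (n a)).all (p a) := by
  have h : Computable₂ fun (a : α) (x : ℕ × Bool) => x.2 && p a x.1 :=
    Primrec.and.to_comp.comp₂ (Computable.snd.comp Computable.snd).to₂
      (hp.comp Computable.fst (Computable.fst.comp Computable.snd)).to₂
  refine (Computable.nat_rec hn (Computable.const true) h).of_eq fun a => ?_
  induction n a with
  | zero => rfl
  | succ k ih => simp only [List.range_succ, List.all_append, ← ih]; simp

theorem computable_any_range {p : α → ℕ → Bool} {n : α → ℕ} (hn : Computable n)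
    (hp : Computable₂ p) : Computable fun a => (List.range (n a)).any (p a) := by
  refine (Primrec.not.to_comp.comp (computable_all_range hn
    (Primrec.not.to_comp.comp₂ hp))).of_eq fun a => ?_
  rw [List.any_eq_not_all_not]

/-- Reduces to a bounded quantifier over the positions in the list; the default `true` is never
reached there. -/
theorem computable_all {p : α → β → Bool} {l : α → List β} (hl : Computable l)
    (hp : Computable₂ p) : Computable fun a => (l a).all (p a) := by
  have h : Computable₂ fun (a : α) (i : ℕ) => (((l a)[i]?).map (p a)).getD true := by
    refine Computable.option_getD (Computable.option_map ?_ ?_) (Computable.const true)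
    · exact Computable.list_getElem?.comp (hl.comp Computable.fst) Computable.snd
    · exact hp.comp₂ (Computable.fst.comp Computable.fst).to₂ Computable.snd.to₂
  refine (computable_all_range (Computable.list_length.comp hl) h).of_eq fun a => ?_
  rw [Bool.eq_iff_iff, List.all_eq_true, List.all_eq_true]
  simp only [List.mem_range]
  constructor
  · intro h x hx
    obtain ⟨i, hi, rfl⟩ := List.mem_iff_getElem.1 hx
    have := h i hi
    rwa [List.getElem?_eq_getElem hi] at this
  · intro h i hi
    rw [List.getElem?_eq_getElem hi]
    exact h _ (List.getElem_mem hi)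

theorem computable_getD : Computable₂ fun (l : List ℕ) (n : ℕ) => l.getD n 0 :=
  (Primrec.list_getD 0).to_comp

theorem computable_half_length : Computable fun v : List ℕ => v.length / 2 :=
  (Primrec.nat_div.comp Primrec.list_length (Primrec.const 2)).to_comp

theorem computable_evens : Computable evens :=
  computable_map_range computable_half_length
    (computable_getD.comp Computable.fst
      (Primrec.nat_mul.to_comp.comp (Computable.const 2) Computable.snd)).to₂

theorem computable_odds : Computable odds :=
  computable_map_range computable_half_length
    (computable_getD.comp Computable.fst (Computable.succ.comp
      (Primrec.nat_mul.to_comp.comp (Computable.const 2) Computable.snd))).to₂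

theorem computable_interleave : Computable₂ interleave := by
  refine computable_map_range (α := List ℕ × List ℕ) (f := fun x j =>
    bif j % 2 == 0 then x.1.getD (j / 2) 0 else x.2.getD (j / 2) 0) ?_ ?_
  · exact (Primrec.nat_mul.comp (Primrec.const 2) (Primrec.nat_min.comp
      (Primrec.list_length.comp Primrec.fst) (Primrec.list_length.comp Primrec.snd))).to_comp
  · have half : Primrec fun x : (List ℕ × List ℕ) × ℕ => x.2 / 2 :=
      Primrec.nat_div.comp Primrec.snd (Primrec.const 2)
    exact (Primrec.cond (Primrec.beq.comp (Primrec.nat_mod.comp Primrec.snd (Primrec.const 2))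
      (Primrec.const 0))
      ((Primrec.list_getD 0).comp (Primrec.fst.comp Primrec.fst) half)
      ((Primrec.list_getD 0).comp (Primrec.snd.comp Primrec.fst) half)).to_comp

theorem computable_conflict : Computable₂ conflict := by
  refine computable_any_range (α := List ℕ × List ℕ) (p := fun x j =>
    !(x.1.getD j 0 == 0) && decide (x.2[j.unpair.1]? = some (j.unpair.2 % 2)))
    (Computable.list_length.comp Computable.fst) ?_
  refine Primrec.to_comp (Primrec.and.comp (Primrec.not.comp (Primrec.beq.comp
    ((Primrec.list_getD 0).comp (Primrec.fst.comp Primrec.fst) Primrec.snd) (Primrec.const 0)))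
    (Primrec.beq.comp (Primrec.list_getElem?.comp (Primrec.snd.comp Primrec.fst)
      (Primrec.fst.comp (Primrec.unpair.comp Primrec.snd)))
      (Primrec.option_some.comp (Primrec.nat_mod.comp
        (Primrec.snd.comp (Primrec.unpair.comp Primrec.snd)) (Primrec.const 2)))))

theorem computable_binWords : Computable binWords := by
  refine (Primrec.of_eq (Primrec.nat_rec₁ (f := fun _ L =>
    L.flatMap fun w => [0 :: w, 1 :: w]) [[]] ?_) fun n => ?_).to_comp
  · refine Primrec.list_flatMap Primrec.snd ?_
    have h : ∀ b : ℕ, Primrec fun x : (ℕ × List (List ℕ)) × List ℕ => b :: x.2 := fun b =>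
      Primrec.list_cons.comp (Primrec.const b) Primrec.snd
    exact Primrec.list_cons.comp (h 0) (Primrec.list_cons.comp (h 1) (Primrec.const []))
  · induction n with
    | zero => rfl
    | succ n ih => simp only [binWords, ← ih]

theorem computable_dead {B : List ℕ → List ℕ → Bool} (hB : Computable₂ B) :
    Computable₂ (dead B) :=
  computable_all (α := List ℕ × List ℕ) (p := fun x w => B x.1 (x.2 ++ w))
    (computable_binWords.comp (Computable.list_length.comp Computable.fst))
    (hB.comp (Computable.fst.comp Computable.fst)
      (Computable.list_append.comp (Computable.snd.comp Computable.fst) Computable.snd))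

theorem computable_deadChild {B : List ℕ → List ℕ → Bool} (hB : Computable₂ B)
    {u : α → List ℕ} {i m : α → ℕ} (hu : Computable u) (hi : Computable i) (hm : Computable m) :
    Computable fun a => deadChild B (u a) (i a) (m a) := by
  have hpar : Computable fun a => m a % 2 := Primrec.nat_mod.to_comp.comp hm (Computable.const 2)
  have hσ : Computable fun a => Denumerable.ofNat (List ℕ) (i a) := (Computable.ofNat _).comp hi
  exact Primrec.and.to_comp.comp
    ((computable_dead hB).comp hu (Computable.list_concat.comp hσ hpar))
    (Primrec.not.to_comp.comp ((computable_dead hB).comp hu (Computable.list_concat.comp hσ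
      (Primrec.nat_sub.to_comp.comp (Computable.const 1) hpar))))

theorem computable_llpoWord {B : List ℕ → List ℕ → Bool} (hB : Computable₂ B) :
    Computable (llpoWord B) := by
  refine computable_map_range Computable.list_length ?_
  have hi : Computable fun x : List ℕ × ℕ => x.2.unpair.1 :=
    Computable.fst.comp (Computable.unpair.comp Computable.snd)
  have hm : Computable fun x : List ℕ × ℕ => x.2.unpair.2 :=
    Computable.snd.comp (Computable.unpair.comp Computable.snd)
  refine Computable.cond (Primrec.and.to_comp.comp
    (computable_deadChild hB (Primrec.list_take.to_comp.comp hm Computable.fst) hi hm)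
    (computable_all_range hm ?_)) (Computable.const 1) (Computable.const 0)
  exact Primrec.not.to_comp.comp (computable_deadChild hB
    (Primrec.list_take.to_comp.comp Computable.snd (Computable.fst.comp Computable.fst))
    (hi.comp Computable.fst) Computable.snd)

theorem computable_walk : Computable walk := by
  have h : Computable₂ fun (v : List ℕ) (x : ℕ × List ℕ) => walkStep v x.2 := by
    have hw : Computable fun y : List ℕ × ℕ × List ℕ => y.2.2 :=
      Computable.snd.comp Computable.snd
    have ho : Computable fun y : List ℕ × ℕ × List ℕ => y.1[Encodable.encode y.2.2]? :=
      Computable.list_getElem?.comp Computable.fst (Computable.encode.comp hw)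
    refine (Computable.option_casesOn ho hw
      (Computable.list_concat.comp (hw.comp Computable.fst) Computable.snd).to₂).of_eq ?_
    rintro ⟨v, k, w⟩
    simp only [walkStep]
    cases v[Encodable.encode w]? <;> simp
  exact Computable.nat_rec Computable.list_length (Computable.const []) h

theorem computable_bad {κ₁ φ₁ κ₂ : List ℕ → List ℕ} (hκ₁ : Computable κ₁) (hφ₁ : Computable φ₁)
    (hκ₂ : Computable κ₂) : Computable₂ (bad κ₁ φ₁ κ₂) := by
  have he : Computable fun x : List ℕ × List ℕ => evens x.2 :=
    computable_evens.comp Computable.snd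
  exact Primrec.or.to_comp.comp
    (computable_conflict.comp (hκ₁.comp Computable.fst) he)
    (computable_conflict.comp
      (hκ₂.comp (hφ₁.comp (computable_interleave.comp Computable.fst he)))
      (computable_odds.comp Computable.snd))

theorem computable_compOut {φ₁ φ₂ : List ℕ → List ℕ} (hφ₁ : Computable φ₁) (hφ₂ : Computable φ₂) :
    Computable (compOut φ₁ φ₂) := by
  have hw := computable_walk.comp computable_odds
  exact hφ₂.comp (computable_interleave.comp
    (hφ₁.comp (computable_interleave.comp computable_evens (computable_evens.comp hw)))
    (computable_odds.comp hw))

end Computability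

end Weihrauch

theorem mainTheorem5 {X Y Z : Type*}
    (δX : Weihrauch.Representation X) (δY : Weihrauch.Representation Y)
    (δZ : Weihrauch.Representation Z)
    (f : Weihrauch.MultiFun X Y) (g : Weihrauch.MultiFun Y Z) :
    (Weihrauch.WeaklyComputable δX δY f → Weihrauch.WeaklyComputable δY δZ g →
      Weihrauch.WeaklyComputable δX δZ (Weihrauch.MultiFun.comp g f)) ∧
    (Weihrauch.WeaklyContinuous δX δY f → Weihrauch.WeaklyContinuous δY δZ g →
      Weihrauch.WeaklyContinuous δX δZ (Weihrauch.MultiFun.comp g f)) := by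
  simp only [Weihrauch.weaklyComputable_iff, Weihrauch.weaklyContinuous_iff]
  refine ⟨Weihrauch.WordReducible.comp ?_ ?_, Weihrauch.WordReducible.comp ?_ ?_⟩
  · exact fun _ _ _ h₁ h₂ h₃ =>
      Weihrauch.computable_llpoWord (Weihrauch.computable_bad h₁ h₂ h₃)
  · exact fun _ _ h₁ h₂ => Weihrauch.computable_compOut h₁ h₂
  -- In the continuous version every word function is admitted, so both closure conditions are void.
  · exact fun _ _ _ _ _ _ => trivial
  · exact fun _ _ _ _ => trivial
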